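/- **Setting.** Let $L,\nu>0$ and $\Phi(u)=\nu|u|^4u$ for $u\in\mathbb R^3$. Fields on the torus $[0,L]^3$ are $L$-periodic functions on $\mathbb R^3$, and $\langle f,g\rangle=\int_{[0,L]^3}f\cdot g\,dx$. Let $\mathcal D^\infty$ be the space of smooth periodic divergence free fields with zero mean, and $H$ its closure in $\mathbb L^2$. For $\varphi\in\mathcal D^\infty$ set $$|\varphi|_{\mathbb X}^6=\int_{[0,L]^3}\Big\{|\varphi|^4|\nabla \varphi|^2+4|\varphi|^2\sum_{i=1}^3(\varphi\cdot\partial_i\varphi)^2\Big\}dx ;$$ for $f\in\mathbb L^2$ let $|f|_{\mathbb X}^6\in[0,\infty]$ be the infimum of $\liminf_n|\varphi_n|^6_{\mathbb X}$ over all sequences $\varphi_n\in\mathcal D^\infty$ with $\varphi_n\to f$ in $\mathbb L^2$. Let $\mathbb Z^3_+=\{k_1>0\}\cup\{k_1=0,k_2>0\}\cup\{k_1=k_2=0,k_3>0\}\subset\mathbb Z^3$; for $k\in\mathbb Z^3_+$ let $v_{k,1},v_{k,2}$ be orthogonal unit vectors in the plane orthogonal to $k$, and for $a=1,2$ let $$h_{k,a}(x)=\tfrac{\sqrt2}{L^{3/2}}v_{k,a}\cos(\tfrac{2\pi}Lk\cdot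 x),\qquad h_{k,a+2}(x)=\tfrac{\sqrt2}{L^{3/2}}v_{k,a}\sin(\tfrac{2\pi}Lk\cdot x).$$ Let $\sigma_{k,j}\in\mathbb R$ with $\sum_{k,j}\sigma_{k,j}^2<\infty$. Let $(\Omega,\mathcal F,(\mathcal F_t)_{t\ge0},Q,(\beta_{k,j}))$ be a Brownian stochastic basis: the $\beta_{k,j}$ are independent standard real Brownian motions, adapted to $(\mathcal F_t)$, with $\beta_{k,j}(t)-\beta_{k,j}(s)$ independent of $\mathcal F_s$ for $s\le t$. **Weak solutions.** A process $u$ is a weak solution on $[0,L]^3$ of $$du+\big[-\Delta\Phi(u)+(u\cdot\nabla)u+\nabla q\big]dt=\sum_{k,j}\sigma_{k,j}\,d\beta_{k,j}(t)\,h_{k,j},\qquad \operatorname{div}u=0,$$ if it is adapted, if almost surely its paths are weakly continuous in $H$, bounded in $H$ on each $[0,T]$, and satisfy $\int_0^T|u_s|_{\mathbb X}^6ds<\infty$ for all $T$, and if for every $\psi\in\mathcal D^\infty$, almost surely, for all $t\ge0$, $$\langle u_t,\psi\rangle-\int_0^t\langle\Phi(u_s),\Delta\psi\rangle ds-\int_0^t\int_{[0,L]^3}\sum_{i,j=1}^3u_{s,i}(\partial_i\psi_j)u_{s,j}\,dx\,ds=\langle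 u_0,\psi\rangle+\sum_{k,j}\sigma_{k,j}\beta_{k,j}(t)\langle h_{k,j},\psi\rangle$$ (with integrable time integrands and an unconditionally convergent series). A pressure for $u$ is a random function $q(t,x)$ with almost surely periodic paths that are integrable on $[0,T]\times[0,L]^3$ for all $T$, such that for every smooth periodic field $\psi$ (not necessarily divergence free or of zero mean), almost surely, for all $t\ge 0$, the same identity holds with the additional term $-\int_0^t\int_{[0,L]^3}q\,\operatorname{div}\psi\,dx\,ds$ on the left-hand side. The same notions are used on $[0,L/\lambda]^3$, with other noise fields in place of $h_{k,j}$. **Proposition (scaling of the equation).** Let $u$ be a weak solution on $[0,L]^3$ as above, let $\lambda\in(0,1)$, and set $$u_\lambda(t,x)=\lambda^{-1/3}u(\lambda^{2/3}t,\lambda x),\qquad \beta^\lambda_{k,j}(t)=\lambda^{-1/3}\beta_{k,j}(\lambda^{2/3}t),\qquad h^\lambda_{k,j}(x)=h_{k,j}(\lambda x),\qquad \mathcal F^\lambda_t=\mathcal F_{\lambda^{2/3}t}.$$ Then: 1. $(\Omega,\mathcal F,(\mathcal F^\lambda_t),Q,(\beta^\lambda_{k,j}))$ is a Brownian stochastic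 basis; in particular the $\beta^\lambda_{k,j}$ are independent standard Brownian motions. 2. $u_\lambda$ is a weak solution on $[0,L/\lambda]^3$, with respect to this basis, of $$du_\lambda+\big[-\Delta\Phi(u_\lambda)+(u_\lambda\cdot\nabla)u_\lambda+\nabla q_\lambda\big]dt=\sum_{k,j}\sigma_{k,j}\,d\beta^\lambda_{k,j}(t)\,h^\lambda_{k,j},\qquad\operatorname{div}u_\lambda=0,$$ with the same $\Phi$ and the same coefficients $\sigma_{k,j}$. 3. If $u$ has a pressure $q$, then $u_\lambda$ has a pressure $q_\lambda$ in this equation. -/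

import Mathlib

open MeasureTheory ProbabilityTheory Filter Topology
open scoped NNReal ENNReal

noncomputable section

namespace Prouse

/-- Euclidean space `ℝ³`. -/
abbrev E3 : Type := EuclideanSpace ℝ (Fin 3)

/-! ### Fields on the torus `[0, L]³`

A field on the torus is an `L`-periodic function on `ℝ³`; spatial integrals run over `[0, L]³`. -/

/-- The cube `[0, L]³`. -/
def cube (L : ℝ) : Set E3 := {x | ∀ i, x i ∈ Set.Icc 0 L}

/-- The lattice vector `L n` with `n ∈ ℤ³`. -/
def latticeVec (L : ℝ) (n : Fin 3 → ℤ) : E3 := WithLp.toLp 2 fun i => L * (n i : ℝ)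

/-- `f` is periodic with period `L` in each coordinate. -/
def IsPeriodic {α : Type*} (L : ℝ) (f : E3 → α) : Prop :=
  ∀ (n : Fin 3 → ℤ) (x : E3), f (x + latticeVec L n) = f x

/-- Periodicity up to null sets, for fields that are defined up to null sets. -/
def IsAEPeriodic {α : Type*} (L : ℝ) (f : E3 → α) : Prop :=
  ∀ n : Fin 3 → ℤ, ∀ᵐ x : E3, f (x + latticeVec L n) = f x

/-- The partial derivative `∂ᵢ f (x)`. -/
def partialD (f : E3 → E3) (i : Fin 3) (x : E3) : E3 :=
  fderiv ℝ f x (EuclideanSpace.single i 1)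

/-- The divergence `∑ᵢ ∂ᵢ fᵢ (x)`. -/
def divergence (f : E3 → E3) (x : E3) : ℝ := ∑ i, partialD f i x i

/-- The pairing `∫_{[0,L]³} f · g dx`. -/
def pairing (L : ℝ) (f g : E3 → E3) : ℝ := ∫ x in cube L, inner ℝ (f x) (g x)

/-- Smooth periodic vector fields. -/
def IsSmoothField (L : ℝ) (ψ : E3 → E3) : Prop := ContDiff ℝ ((⊤ : ℕ∞) : WithTop ℕ∞) ψ ∧ IsPeriodic L ψ

/-- The space `𝒟^∞`: smooth, periodic, divergence free fields with zero mean. -/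
structure IsTestField (L : ℝ) (ψ : E3 → E3) : Prop where
  smooth : ContDiff ℝ ((⊤ : ℕ∞) : WithTop ℕ∞) ψ
  periodic : IsPeriodic L ψ
  div_free : ∀ x, divergence ψ x = 0
  zero_mean : ∫ x in cube L, ψ x = 0

/-- The sequence `φ n` converges to `f` in `𝕃²` of the torus. -/
def TendstoL2 (L : ℝ) (φ : ℕ → E3 → E3) (f : E3 → E3) : Prop :=
  Tendsto (fun n => eLpNorm (fun x => φ n x - f x) 2 (volume.restrict (cube L))) atTop (𝓝 0)

/-- The space `H`: the closure of `𝒟^∞` in `𝕃²`. -/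
structure MemH (L : ℝ) (f : E3 → E3) : Prop where
  periodic : IsAEPeriodic L f
  memLp : MemLp f 2 (volume.restrict (cube L))
  closure : ∃ φ : ℕ → E3 → E3, (∀ n, IsTestField L (φ n)) ∧ TendstoL2 L φ f

/-- For a smooth field `φ`, the quantity
`|φ|_𝕏⁶ = ∫ (|φ|⁴ |∇φ|² + 4 |φ|² ∑ᵢ (φ · ∂ᵢφ)²) dx`. -/
def smoothX6 (L : ℝ) (φ : E3 → E3) : ℝ :=
  ∫ x in cube L, (‖φ x‖ ^ 4 * ∑ i, ‖partialD φ i x‖ ^ 2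
    + 4 * ‖φ x‖ ^ 2 * ∑ i, (inner ℝ (φ x) (partialD φ i x)) ^ 2)

/-- `|f|_𝕏⁶` for a field `f` of `𝕃²`: the infimum of `liminf |φₙ|_𝕏⁶` over the sequences `φₙ` in
`𝒟^∞` that converge to `f` in `𝕃²` (and `∞` when all these are infinite). The space `𝕏`, the closure
of `𝒟^∞` under `|·|_𝕏`, consists of the fields for which it is finite. -/
def X6 (L : ℝ) (f : E3 → E3) : ℝ≥0∞ :=
  ⨅ (φ : ℕ → E3 → E3) (_ : (∀ n, IsTestField L (φ n)) ∧ TendstoL2 L φ f),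
    liminf (fun n => ENNReal.ofReal (smoothX6 L (φ n))) atTop

/-! ### The terms of the equation -/

/-- The nonlinearity `Φ(u) = ν |u|⁴ u`. -/
def Phi (ν : ℝ) (u : E3) : E3 := (ν * ‖u‖ ^ 4) • u

/-- `⟨Φ(u), Aψ⟩` with `A = -Δ`. -/
def viscousTerm (L ν : ℝ) (u ψ : E3 → E3) : ℝ :=
  pairing L (fun x => Phi ν (u x)) (fun x => -((Laplacian.laplacian ψ : E3 → E3) x))

/-- `⟨B(u, ψ), u⟩ = ∑ᵢⱼ ∫ uᵢ (∂ᵢ ψⱼ) uⱼ dx`. -/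
def transportTerm (L : ℝ) (u ψ : E3 → E3) : ℝ :=
  ∫ x in cube L, ∑ i, ∑ j, u x i * partialD ψ i x j * u x j

/-! ### The noise -/

/-- The half space `ℤ³₊`. -/
def ZPlus : Type :=
  {k : Fin 3 → ℤ // 0 < k 0 ∨ (k 0 = 0 ∧ 0 < k 1) ∨ (k 0 = 0 ∧ k 1 = 0 ∧ 0 < k 2)}

/-- The index set of the eigenvectors: pairs `(k, j)` with `k ∈ ℤ³₊` and four values of `j`. -/
abbrev Idx : Type := ZPlus × Fin 4

/-- The wave vector `k` as an element of `ℝ³`. -/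
def waveVec (k : ZPlus) : E3 := WithLp.toLp 2 fun i => (k.1 i : ℝ)

/-- For each `k`, the vectors `v k 0` and `v k 1` are an orthonormal pair in the plane orthogonal
to `k`. -/
structure IsPolarization (v : ZPlus → Fin 2 → E3) : Prop where
  orthonormal : ∀ k, Orthonormal ℝ (v k)
  orthogonal : ∀ k a, inner ℝ (v k a) (waveVec k) = 0

/-- The eigenvectors `h_{k,j}` of `A` on the torus `[0, L]³`. -/
def eigenField (L : ℝ) (v : ZPlus → Fin 2 → E3) (i : Idx) (x : E3) : E3 :=
  let c : ℝ := √2 / L ^ (3 / 2 : ℝ)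
  let θ : ℝ := 2 * Real.pi / L * inner ℝ (waveVec i.1) x
  ![(c * Real.cos θ) • v i.1 0, (c * Real.cos θ) • v i.1 1,
    (c * Real.sin θ) • v i.1 0, (c * Real.sin θ) • v i.1 1] i.2

/-- `(Ω, 𝓕, Q)` with the processes `β` is a Brownian stochastic basis: the `β i` are independent
standard Brownian motions, adapted to `𝓕`, with increments after `s` independent of `𝓕 s`. -/
structure IsBrownianBasis {Ω ι : Type*} {m : MeasurableSpace Ω} (Q : Measure Ω)
    (𝓕 : Filtration ℝ≥0 m) (β : ι → ℝ≥0 → Ω → ℝ) : Prop where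
  brownian : ∀ i, IsBrownianReal (β i) Q
  independent : iIndepFun (fun i ω (t : ℝ≥0) => β i t ω) Q
  adapted : ∀ i t, Measurable[𝓕 t] (β i t)
  indep_increments : ∀ i (s t : ℝ≥0), s ≤ t →
    Indep (MeasurableSpace.comap (fun ω => β i t ω - β i s ω) inferInstance) (𝓕 s) Q

/-! ### Solutions of
`du + [-ΔΦ(u) + (u·∇)u + ∇q] dt = ∑ᵢ σᵢ dβᵢ eᵢ`, `div u = 0`, on the torus `[0, L]³` -/

/-- `u` is a weak solution: it is adapted, its paths are almost surely weakly continuous in `H`,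
lie in `L^∞(0,T;H) ∩ L⁶(0,T;𝕏)` for all `T`, and satisfy the equation tested against the fields
`ψ ∈ 𝒟^∞`, that is
`⟨u_t,ψ⟩ + ∫₀ᵗ ⟨Φ(u_s),Aψ⟩ ds - ∫₀ᵗ ⟨B(u_s,ψ),u_s⟩ ds = ⟨u_0,ψ⟩ + ∑ᵢ σᵢ βᵢ(t) ⟨eᵢ,ψ⟩`. -/
structure IsWeakSolution {Ω ι : Type*} {m : MeasurableSpace Ω} (Q : Measure Ω)
    (𝓕 : Filtration ℝ≥0 m) (β : ι → ℝ≥0 → Ω → ℝ) (L ν : ℝ) (σ : ι → ℝ) (e : ι → E3 → E3)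
    (u : ℝ≥0 → Ω → E3 → E3) : Prop where
  adapted : ∀ t v, MemH L v → Measurable[𝓕 t] fun ω => pairing L (u t ω) v
  memH : ∀ᵐ ω ∂Q, ∀ t, MemH L (u t ω)
  weakly_continuous : ∀ᵐ ω ∂Q, ∀ v, MemH L v → Continuous fun t => pairing L (u t ω) v
  bounded : ∀ᵐ ω ∂Q, ∀ T : ℝ≥0, ∃ C : ℝ, ∀ t ≤ T, pairing L (u t ω) (u t ω) ≤ C
  memX : ∀ᵐ ω ∂Q, ∀ T : ℝ≥0, ∫⁻ s in Set.Icc (0 : ℝ) T, X6 L (u s.toNNReal ω) < ∞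
  equation : ∀ ψ, IsTestField L ψ → ∀ᵐ ω ∂Q, ∀ t : ℝ≥0,
    IntervalIntegrable (fun s : ℝ => viscousTerm L ν (u s.toNNReal ω) ψ) volume 0 t ∧
    IntervalIntegrable (fun s : ℝ => transportTerm L (u s.toNNReal ω) ψ) volume 0 t ∧
    HasSum (fun i => σ i * β i t ω * pairing L (e i) ψ)
      (pairing L (u t ω) ψ - pairing L (u 0 ω) ψ
        + (∫ s in (0 : ℝ)..t, viscousTerm L ν (u s.toNNReal ω) ψ)
        - ∫ s in (0 : ℝ)..t, transportTerm L (u s.toNNReal ω) ψ)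

/-- `q` is a pressure for `u`: its paths are almost surely periodic and locally integrable in space
and time, and the unprojected equation, with the term `∇q dt`, holds in the sense of distributions
in space, that is, tested against all smooth periodic fields `ψ`. -/
structure IsPressure {Ω ι : Type*} {m : MeasurableSpace Ω} (Q : Measure Ω)
    (β : ι → ℝ≥0 → Ω → ℝ) (L ν : ℝ) (σ : ι → ℝ) (e : ι → E3 → E3)
    (u : ℝ≥0 → Ω → E3 → E3) (q : ℝ≥0 → Ω → E3 → ℝ) : Prop where
  periodic : ∀ᵐ ω ∂Q, ∀ᵐ s ∂(volume.restrict (Set.Ici (0 : ℝ))), IsAEPeriodic L (q s.toNNReal ω)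
  integrable : ∀ᵐ ω ∂Q, ∀ T : ℝ≥0,
    IntegrableOn (fun p : ℝ × E3 => q p.1.toNNReal ω p.2) (Set.Icc 0 (T : ℝ) ×ˢ cube L)
  equation : ∀ ψ, IsSmoothField L ψ → ∀ᵐ ω ∂Q, ∀ t : ℝ≥0,
    IntervalIntegrable (fun s : ℝ => viscousTerm L ν (u s.toNNReal ω) ψ) volume 0 t ∧
    IntervalIntegrable (fun s : ℝ => transportTerm L (u s.toNNReal ω) ψ) volume 0 t ∧
    HasSum (fun i => σ i * β i t ω * pairing L (e i) ψ)
      (pairing L (u t ω) ψ - pairing L (u 0 ω) ψ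
        + (∫ s in (0 : ℝ)..t, viscousTerm L ν (u s.toNNReal ω) ψ)
        - (∫ s in (0 : ℝ)..t, transportTerm L (u s.toNNReal ω) ψ)
        - ∫ s in (0 : ℝ)..t, ∫ x in cube L, q s.toNNReal ω x * divergence ψ x)

/-! ### The scaling transformation -/

/-- `u_lam (t, x) = lam^{-1/3} u (lam^{2/3} t, lam x)`. -/
def scaledVelocity {Ω : Type*} (lam : ℝ≥0) (u : ℝ≥0 → Ω → E3 → E3) : ℝ≥0 → Ω → E3 → E3 :=
  fun t ω x => ((lam : ℝ) ^ (-1 / 3 : ℝ)) • u (lam ^ (2 / 3 : ℝ) * t) ω ((lam : ℝ) • x)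

/-- `β^lam (t) = lam^{-1/3} β (lam^{2/3} t)`. -/
def scaledNoise {Ω ι : Type*} (lam : ℝ≥0) (β : ι → ℝ≥0 → Ω → ℝ) : ι → ℝ≥0 → Ω → ℝ :=
  fun i t ω => (lam : ℝ) ^ (-1 / 3 : ℝ) * β i (lam ^ (2 / 3 : ℝ) * t) ω

/-- `h^lam (x) = h (lam x)`. -/
def scaledField {ι : Type*} (lam : ℝ≥0) (e : ι → E3 → E3) : ι → E3 → E3 :=
  fun i x => e i ((lam : ℝ) • x)

/-- The filtration `𝓕^lam_t = 𝓕_{lam^{2/3} t}`. -/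
def scaledFiltration {Ω : Type*} {m : MeasurableSpace Ω} (lam : ℝ≥0) (𝓕 : Filtration ℝ≥0 m) :
    Filtration ℝ≥0 m where
  seq t := 𝓕 (lam ^ (2 / 3 : ℝ) * t)
  mono' := fun _ _ h => 𝓕.mono (by gcongr)
  le' := fun _ => 𝓕.le _

end Prouse

end

noncomputable section

namespace Prouse

/-! ### Dilations of fields -/

/-! Write a = λ^(-1/3) for the amplitude, c = λ for the space scale and τ = λ^(2/3) for the time
scale, so that c = a⁻³ and τ = a⁻² (`amplitude_pow`). A test field ψ on the torus of side L/λ is the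
dilation of ψ(λ⁻¹ ·), a test field on the torus of side L. Each term of the scaled equation tested
against ψ is therefore a constant times the same term of the original equation at time τt, tested
against ψ(λ⁻¹ ·).

With the Jacobian c⁻³ in space and τ⁻¹ in time, the constants are: a c⁻³ for ⟨u, ψ⟩; a⁵c²c⁻³τ⁻¹ for
the viscous term (degree five in u, two derivatives); a²c c⁻³τ⁻¹ for the transport term (degree two,
one derivative); a c⁻³ for the noise. They agree exactly when a⁴c² = τ = ac, which holds since both
sides are a⁻². Brownian scaling asks for a = τ^(-1/2), which also holds: the degree five of Φ is
what lets the coefficients σ stay unchanged. A pressure scales like |u|², with amplitude a².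

`equation_scaled` carries out this comparison, for the projected and the unprojected equation at
once. The conditions on paths transfer because dilations carry 𝒟^∞, 𝕃² convergence, H and the 𝕏
functional of one torus to those of the other. -/

/-- The field `x ↦ a f (c x)`. -/
def dilate (a c : ℝ) (f : E3 → E3) : E3 → E3 := fun x => a • f (c • x)

lemma dilate_one_inv {c : ℝ} (hc : c ≠ 0) (f : E3 → E3) :
    dilate 1 c (dilate 1 c⁻¹ f) = f := by
  ext1 x
  simp [dilate, smul_smul, hc]

lemma preimage_smul_cube {c : ℝ} (hc : 0 < c) (L : ℝ) :
    (fun x : E3 => c • x) ⁻¹' cube L = cube (L / c) := by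
  ext x
  simp only [cube, Set.mem_preimage, Set.mem_ofPred_eq, PiLp.smul_apply, smul_eq_mul, Set.mem_Icc]
  refine forall_congr' fun i => ?_
  rw [le_div_iff₀' hc, mul_nonneg_iff_of_pos_left hc]

lemma measurableEmbedding_smul {c : ℝ} (hc : c ≠ 0) : MeasurableEmbedding fun x : E3 => c • x :=
  (Homeomorph.smulOfNeZero c hc).measurableEmbedding

/-- The one spatial change of variables. Stated as a push-forward along a measurable embedding, it
serves integrals, 𝕃² norms and integrability alike, and the integral formula needs no measurability
of the integrand. -/
lemma map_smul_restrict_cube {c : ℝ} (hc : 0 < c) (L : ℝ) :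
    Measure.map (fun x : E3 => c • x) (volume.restrict (cube (L / c)))
      = ENNReal.ofReal (c ^ 3)⁻¹ • volume.restrict (cube L) := by
  rw [← preimage_smul_cube hc, ← (measurableEmbedding_smul hc.ne').restrict_map,
    Measure.map_addHaar_smul _ hc.ne', Measure.restrict_smul]
  simp [abs_of_pos hc]

lemma setIntegral_cube_comp_smul {F : Type*} [NormedAddCommGroup F] [NormedSpace ℝ F] {c : ℝ}
    (hc : 0 < c) (L : ℝ) (g : E3 → F) :
    ∫ x in cube (L / c), g (c • x) = (c ^ 3)⁻¹ • ∫ x in cube L, g x := by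
  rw [← (measurableEmbedding_smul hc.ne').integral_map (μ := volume.restrict (cube (L / c))) g,
    map_smul_restrict_cube hc, integral_smul_measure, ENNReal.toReal_ofReal (by positivity)]

lemma partialD_dilate (a c : ℝ) (f : E3 → E3) (i : Fin 3) (x : E3) :
    partialD (dilate a c f) i x = (a * c) • partialD f i (c • x) := by
  have : dilate a c f = a • fun x => f (c • x) := rfl
  rw [partialD, this, fderiv_const_smul_field, Pi.smul_apply, fderiv_comp_smul, partialD]
  simp [smul_smul]

lemma divergence_dilate (a c : ℝ) (f : E3 → E3) (x : E3) :
    divergence (dilate a c f) x = a * c * divergence f (c • x) := by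
  simp [divergence, partialD_dilate, Finset.mul_sum]

lemma laplacian_dilate (a c : ℝ) {f : E3 → E3} (hf : ContDiff ℝ 2 f) (x : E3) :
    (Laplacian.laplacian (dilate a c f) : E3 → E3) x
      = (a * c ^ 2) • (Laplacian.laplacian f : E3 → E3) (c • x) := by
  have hfc : ContDiff ℝ 2 fun x => f (c • x) := by fun_prop
  have h : dilate a c f = a • fun x => f (c • x) := rfl
  rw [h, InnerProductSpace.laplacian_smul a hfc.contDiffAt,
    InnerProductSpace.laplacian_eq_iteratedFDeriv_stdOrthonormalBasis,
    InnerProductSpace.laplacian_eq_iteratedFDeriv_stdOrthonormalBasis]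
  simp only [iteratedFDeriv_comp_const_smul c (i := 2) hf]
  simp [Finset.smul_sum, smul_smul]

lemma contDiff_dilate (a c : ℝ) {n : WithTop ℕ∞} {f : E3 → E3} (hf : ContDiff ℝ n f) :
    ContDiff ℝ n (dilate a c f) := by
  unfold dilate
  fun_prop

lemma smul_add_latticeVec {c : ℝ} (hc : c ≠ 0) (L : ℝ) (n : Fin 3 → ℤ) (x : E3) :
    c • (x + latticeVec (L / c) n) = c • x + latticeVec L n := by
  ext i
  simp [latticeVec]
  field_simp

lemma IsAEPeriodic.comp_smul {α : Type*} {c : ℝ} (hc : c ≠ 0) {L : ℝ} {f : E3 → α}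
    (hf : IsAEPeriodic L f) : IsAEPeriodic (L / c) fun x => f (c • x) := fun n => by
  filter_upwards [(Measure.quasiMeasurePreserving_smul volume hc).ae (hf n)] with x hx
  rw [smul_add_latticeVec hc, hx]

lemma IsAEPeriodic.comp {α γ : Type*} {L : ℝ} {f : E3 → α} (hf : IsAEPeriodic L f) (g : α → γ) :
    IsAEPeriodic L fun x => g (f x) := fun n => by
  filter_upwards [hf n] with x hx
  rw [hx]

lemma IsSmoothField.dilate {c : ℝ} (hc : c ≠ 0) {L : ℝ} {ψ : E3 → E3} (hψ : IsSmoothField L ψ)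
    (a : ℝ) : IsSmoothField (L / c) (dilate a c ψ) :=
  ⟨contDiff_dilate a c hψ.1, fun n x => by
    simp only [Prouse.dilate, smul_add_latticeVec hc, hψ.2 n]⟩

lemma IsTestField.dilate {c : ℝ} (hc : 0 < c) {L : ℝ} {ψ : E3 → E3} (hψ : IsTestField L ψ)
    (a : ℝ) : IsTestField (L / c) (dilate a c ψ) where
  smooth := contDiff_dilate a c hψ.smooth
  periodic := (IsSmoothField.dilate hc.ne' ⟨hψ.smooth, hψ.periodic⟩ a).2
  div_free x := by rw [divergence_dilate, hψ.div_free, mul_zero]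
  zero_mean := by
    simp only [Prouse.dilate]
    rw [integral_smul, setIntegral_cube_comp_smul hc, hψ.zero_mean, smul_zero, smul_zero]

lemma eLpNorm_dilate {c : ℝ} (hc : 0 < c) (a L : ℝ) (f : E3 → E3) :
    eLpNorm (dilate a c f) 2 (volume.restrict (cube (L / c)))
      = ‖a‖ₑ * (ENNReal.ofReal (c ^ 3)⁻¹ ^ (1 / 2 : ℝ)
        * eLpNorm f 2 (volume.restrict (cube L))) := by
  have h : dilate a c f = a • (f ∘ fun x => c • x) := rfl
  rw [h, eLpNorm_const_smul, ← (measurableEmbedding_smul hc.ne').eLpNorm_map_measure,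
    map_smul_restrict_cube hc, eLpNorm_smul_measure_of_ne_top (by simp)]
  simp

lemma TendstoL2.dilate {c : ℝ} (hc : 0 < c) {L : ℝ} {φ : ℕ → E3 → E3} {f : E3 → E3}
    (h : TendstoL2 L φ f) (a : ℝ) :
    TendstoL2 (L / c) (fun n => dilate a c (φ n)) (dilate a c f) := by
  have key : ∀ n, (fun x => Prouse.dilate a c (φ n) x - Prouse.dilate a c f x)
      = Prouse.dilate a c fun x => φ n x - f x := fun n => by
    ext1 x
    simp [Prouse.dilate, smul_sub]
  unfold TendstoL2 at h ⊢
  simp only [key, eLpNorm_dilate hc]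
  have h1 := ENNReal.Tendsto.const_mul (a := ENNReal.ofReal (c ^ 3)⁻¹ ^ (1 / 2 : ℝ)) h
    (Or.inr (by finiteness))
  have h2 := ENNReal.Tendsto.const_mul (a := ‖a‖ₑ) h1 (Or.inr (by finiteness))
  simpa using h2

lemma MemH.dilate {c : ℝ} (hc : 0 < c) {L : ℝ} {f : E3 → E3} (hf : MemH L f) (a : ℝ) :
    MemH (L / c) (dilate a c f) where
  periodic := (hf.periodic.comp_smul hc.ne').comp fun y => a • y
  memLp := by
    refine MemLp.const_smul (f := fun x => f (c • x)) ?_ a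
    refine ((measurableEmbedding_smul hc.ne').memLp_map_measure_iff (g := f)).1 ?_
    rw [map_smul_restrict_cube hc]
    exact hf.memLp.smul_measure (by finiteness)
  closure := by
    obtain ⟨φ, hφ, hφf⟩ := hf.closure
    exact ⟨fun n => Prouse.dilate a c (φ n), fun n => (hφ n).dilate hc a, hφf.dilate hc a⟩

/-! ### Scaling of the functionals -/

lemma pairing_dilate {c : ℝ} (hc : 0 < c) (a b L : ℝ) (f g : E3 → E3) :
    pairing (L / c) (dilate a c f) (dilate b c g) = a * b * (c ^ 3)⁻¹ * pairing L f g := by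
  have h : ∀ x, inner ℝ (dilate a c f x) (dilate b c g x)
      = (fun y => a * b * inner ℝ (f y) (g y)) (c • x) := fun x => by
    simp [dilate, inner_smul_left, inner_smul_right]
    ring
  simp only [pairing, h]
  rw [setIntegral_cube_comp_smul hc L (fun y => a * b * inner ℝ (f y) (g y)), integral_const_mul,
    smul_eq_mul]
  ring

lemma smoothX6_dilate {c : ℝ} (hc : 0 < c) (a L : ℝ) (φ : E3 → E3) :
    smoothX6 (L / c) (dilate a c φ) = a ^ 6 * c ^ 2 * (c ^ 3)⁻¹ * smoothX6 L φ := by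
  unfold smoothX6
  rw [mul_assoc, ← smul_eq_mul (c ^ 3)⁻¹, ← setIntegral_cube_comp_smul hc, ← integral_const_mul]
  congr 1
  ext1 x
  simp only [partialD_dilate, dilate, norm_smul, inner_smul_left, inner_smul_right, mul_pow,
    ← Finset.mul_sum, Real.norm_eq_abs, abs_mul, sq_abs, conj_trivial,
    (show Even 4 by decide).pow_abs]
  ring

/-- Dilating an admissible sequence for `f` gives an admissible sequence for the dilated field, and
`smoothX6` picks up a constant. One inequality suffices, since only finiteness of the time integral
is to be transferred. The constant must be nonzero to pass through infima that may be infinite. -/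
lemma X6_dilate_le {c : ℝ} (hc : 0 < c) {a : ℝ} (ha : a ≠ 0) (L : ℝ) (f : E3 → E3) :
    X6 (L / c) (dilate a c f) ≤ ENNReal.ofReal (a ^ 6 * c ^ 2 * (c ^ 3)⁻¹) * X6 L f := by
  have hK : 0 < a ^ 6 * c ^ 2 * (c ^ 3)⁻¹ := by positivity
  have hK0 : ENNReal.ofReal (a ^ 6 * c ^ 2 * (c ^ 3)⁻¹) ≠ 0 := by simpa using hK
  unfold X6
  rw [ENNReal.mul_iInf_of_ne hK0 ENNReal.ofReal_ne_top]
  refine le_iInf fun φ => ?_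
  rw [ENNReal.mul_iInf_of_ne hK0 ENNReal.ofReal_ne_top]
  refine le_iInf fun hφ => ?_
  refine iInf₂_le_of_le (fun n => dilate a c (φ n))
    ⟨fun n => (hφ.1 n).dilate hc a, hφ.2.dilate hc a⟩ ?_
  simp only [smoothX6_dilate hc, ENNReal.ofReal_mul hK.le]
  rw [ENNReal.liminf_const_mul_of_ne_top ENNReal.ofReal_ne_top]

lemma transportTerm_dilate {c : ℝ} (hc : 0 < c) (a L : ℝ) (f ψ : E3 → E3) :
    transportTerm (L / c) (dilate a c f) (dilate 1 c ψ)
      = a ^ 2 * c * (c ^ 3)⁻¹ * transportTerm L f ψ := by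
  unfold transportTerm
  rw [mul_assoc, ← smul_eq_mul (c ^ 3)⁻¹, ← setIntegral_cube_comp_smul hc, ← integral_const_mul]
  congr 1
  ext1 x
  simp only [partialD_dilate, dilate, PiLp.smul_apply, smul_eq_mul, Finset.mul_sum]
  refine Finset.sum_congr rfl fun i _ => Finset.sum_congr rfl fun j _ => ?_
  ring

lemma viscousTerm_dilate {c : ℝ} (hc : 0 < c) (a L ν : ℝ) (f : E3 → E3) {ψ : E3 → E3}
    (hψ : ContDiff ℝ 2 ψ) :
    viscousTerm (L / c) ν (dilate a c f) (dilate 1 c ψ)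
      = a ^ 5 * c ^ 2 * (c ^ 3)⁻¹ * viscousTerm L ν f ψ := by
  -- Φ is homogeneous of degree five; the norm enters with an even power, so the sign of `a` plays
  -- no role.
  have h1 : (fun x => Phi ν (dilate a c f x)) = dilate (a ^ 5) c fun x => Phi ν (f x) := by
    ext1 x
    simp only [Phi, dilate, norm_smul, smul_smul, mul_pow, Real.norm_eq_abs,
      (show Even 4 by decide).pow_abs]
    congr 1
    ring
  have h2 : (fun x => -((Laplacian.laplacian (dilate 1 c ψ) : E3 → E3) x))
      = dilate (c ^ 2) c fun x => -((Laplacian.laplacian ψ : E3 → E3) x) := by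
    ext1 x
    rw [laplacian_dilate 1 c hψ]
    simp [dilate]
  rw [viscousTerm, h1, h2, pairing_dilate hc, viscousTerm]

lemma pressureTerm_dilate {c : ℝ} (hc : 0 < c) (b L : ℝ) (q : E3 → ℝ) (ψ : E3 → E3) :
    ∫ x in cube (L / c), b * q (c • x) * divergence (dilate 1 c ψ) x
      = b * c * (c ^ 3)⁻¹ * ∫ x in cube L, q x * divergence ψ x := by
  rw [mul_assoc, ← smul_eq_mul (c ^ 3)⁻¹, ← setIntegral_cube_comp_smul hc, ← integral_const_mul]
  congr 1
  ext1 x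
  rw [divergence_dilate]
  ring

/-! ### Scaling of the time variable -/

lemma toNNReal_mul_coe (τ : ℝ≥0) (s : ℝ) : τ * s.toNNReal = ((τ : ℝ) * s).toNNReal := by
  rw [Real.toNNReal_mul τ.coe_nonneg, Real.toNNReal_coe]

lemma measurableEmbedding_mul_left {τ : ℝ} (hτ : τ ≠ 0) : MeasurableEmbedding fun s : ℝ => τ * s :=
  (Homeomorph.mulLeft₀ τ hτ).measurableEmbedding

lemma preimage_mul_Icc {τ : ℝ} (hτ : 0 < τ) (T : ℝ) :
    (fun s : ℝ => τ * s) ⁻¹' Set.Icc 0 (τ * T) = Set.Icc 0 T := by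
  ext s
  simp [mul_nonneg_iff_of_pos_left hτ, mul_le_mul_iff_right₀ hτ]

lemma map_mul_restrict_Icc {τ : ℝ} (hτ : 0 < τ) (T : ℝ) :
    Measure.map (fun s : ℝ => τ * s) (volume.restrict (Set.Icc 0 T))
      = ENNReal.ofReal τ⁻¹ • volume.restrict (Set.Icc 0 (τ * T)) := by
  rw [← preimage_mul_Icc hτ T, ← (measurableEmbedding_mul_left hτ.ne').restrict_map,
    Real.map_volume_mul_left hτ.ne', Measure.restrict_smul, abs_of_pos (inv_pos.2 hτ)]

/-- No measurability of `f` is assumed: it will be s ↦ |u_s|_𝕏⁶, an infimum over an uncountable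
family. -/
lemma lintegral_Icc_comp_mul_left {τ : ℝ} (hτ : 0 < τ) (T : ℝ) (f : ℝ → ℝ≥0∞) :
    ∫⁻ s in Set.Icc 0 T, f (τ * s)
      = ENNReal.ofReal τ⁻¹ * ∫⁻ s in Set.Icc 0 (τ * T), f s := by
  rw [← (measurableEmbedding_mul_left hτ.ne').lintegral_map
    (μ := volume.restrict (Set.Icc 0 T)) f, map_mul_restrict_Icc hτ, lintegral_smul_measure,
    smul_eq_mul]

lemma intervalIntegral_comp_mul_left {τ : ℝ} (hτ : τ ≠ 0) (k t : ℝ) (f : ℝ → ℝ) :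
    ∫ s in (0 : ℝ)..t, k * f (τ * s) = k * τ⁻¹ * ∫ s in (0 : ℝ)..τ * t, f s := by
  rw [intervalIntegral.integral_const_mul, intervalIntegral.integral_comp_mul_left f hτ, mul_zero,
    smul_eq_mul, mul_assoc]

lemma intervalIntegrable_comp_mul_left {τ : ℝ} (hτ : τ ≠ 0) (k t : ℝ) {f : ℝ → ℝ}
    (hf : IntervalIntegrable f volume 0 (τ * t)) :
    IntervalIntegrable (fun s => k * f (τ * s)) volume 0 t := by
  have h := (hf.comp_mul_left (c := τ)).const_mul k
  rwa [zero_div, mul_div_cancel_left₀ t hτ] at h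

lemma integrableOn_Icc_prod_cube_comp_smul {τ c : ℝ} (hτ : 0 < τ) (hc : 0 < c) (T L : ℝ)
    {f : ℝ × E3 → ℝ} (hf : IntegrableOn f (Set.Icc 0 (τ * T) ×ˢ cube L)) :
    IntegrableOn (fun p : ℝ × E3 => f (τ * p.1, c • p.2)) (Set.Icc 0 T ×ˢ cube (L / c)) := by
  have he : MeasurableEmbedding (Prod.map (fun s : ℝ => τ * s) fun x : E3 => c • x) :=
    ((Homeomorph.mulLeft₀ τ hτ.ne').prodCongr
      (Homeomorph.smulOfNeZero c hc.ne')).measurableEmbedding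
  rw [IntegrableOn, Measure.volume_eq_prod, ← Measure.prod_restrict] at hf ⊢
  refine (he.integrable_map_iff (g := f)).1 ?_
  rw [← Measure.map_prod_map _ _ (by fun_prop) (by fun_prop), map_mul_restrict_Icc hτ,
    map_smul_restrict_cube hc, Measure.prod_smul_left, Measure.prod_smul_right]
  exact (hf.smul_measure (by finiteness)).smul_measure (by finiteness)

/-! ### Scaling of the noise -/

/-- The normalization τ^(-1/2) of Brownian scaling is the velocity amplitude a. -/
lemma sqrt_rpow_two_thirds_inv (lam : ℝ≥0) :
    (√((lam ^ (2 / 3 : ℝ) : ℝ≥0) : ℝ))⁻¹ = (lam : ℝ) ^ (-1 / 3 : ℝ) := by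
  rw [NNReal.coe_rpow, Real.sqrt_eq_rpow, ← Real.rpow_mul lam.coe_nonneg,
    ← Real.rpow_neg lam.coe_nonneg]
  norm_num

lemma isBrownianBasis_scaled {Ω ι : Type*} {m : MeasurableSpace Ω} {Q : Measure Ω}
    {𝓕 : Filtration ℝ≥0 m} {β : ι → ℝ≥0 → Ω → ℝ} (hβ : IsBrownianBasis Q 𝓕 β) {lam : ℝ≥0}
    (hlam : 0 < lam) :
    IsBrownianBasis Q (scaledFiltration lam 𝓕) (scaledNoise lam β) where
  brownian i := by
    have h := (hβ.brownian i).smul (NNReal.rpow_pos (p := 2 / 3) hlam).ne'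
    rwa [sqrt_rpow_two_thirds_inv] at h
  independent := by
    refine hβ.independent.comp
      (fun _ (f : ℝ≥0 → ℝ) (t : ℝ≥0) => (lam : ℝ) ^ (-1 / 3 : ℝ) * f (lam ^ (2 / 3 : ℝ) * t))
      fun _ => ?_
    fun_prop
  adapted i t := (hβ.adapted i _).const_mul _
  indep_increments i s t hst := by
    refine indep_of_indep_of_le_left
      (hβ.indep_increments i (lam ^ (2 / 3 : ℝ) * s) (lam ^ (2 / 3 : ℝ) * t) (by gcongr)) ?_
    -- The scaled increment is a measurable function of an original increment, hence generates a
    -- smaller σ-algebra.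
    have h : (fun ω => scaledNoise lam β i t ω - scaledNoise lam β i s ω)
        = (fun x : ℝ => (lam : ℝ) ^ (-1 / 3 : ℝ) * x) ∘
          fun ω => β i (lam ^ (2 / 3 : ℝ) * t) ω - β i (lam ^ (2 / 3 : ℝ) * s) ω := by
      ext1 ω
      simp [scaledNoise, mul_sub]
    rw [h, ← MeasurableSpace.comap_comp]
    exact MeasurableSpace.comap_mono (Measurable.comap_le (by fun_prop))

/-! ### Scaling of the solution -/

lemma scaledVelocity_eq_dilate {Ω : Type*} (lam : ℝ≥0) (u : ℝ≥0 → Ω → E3 → E3) (t : ℝ≥0) (ω : Ω) :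
    scaledVelocity lam u t ω
      = dilate ((lam : ℝ) ^ (-1 / 3 : ℝ)) lam (u (lam ^ (2 / 3 : ℝ) * t) ω) := rfl

lemma scaledField_eq_dilate {ι : Type*} (lam : ℝ≥0) (e : ι → E3 → E3) (i : ι) :
    scaledField lam e i = dilate 1 lam (e i) := by
  ext1 x
  simp [scaledField, dilate]

/-- In terms of the amplitude `a = lam^{-1/3}`, the space scale is `lam = a⁻³` and the time scale is
`lam^{2/3} = a⁻²`. -/
lemma amplitude_pow {lam : ℝ≥0} (hlam : 0 < lam) :
    (lam : ℝ) = (((lam : ℝ) ^ (-1 / 3 : ℝ)) ^ 3)⁻¹ ∧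
    ((lam ^ (2 / 3 : ℝ) : ℝ≥0) : ℝ) = (((lam : ℝ) ^ (-1 / 3 : ℝ)) ^ 2)⁻¹ := by
  have h : (0 : ℝ) < lam := hlam
  rw [NNReal.coe_rpow, ← Real.rpow_mul_natCast h.le, ← Real.rpow_mul_natCast h.le,
    ← Real.rpow_neg h.le, ← Real.rpow_neg h.le]
  norm_num

lemma scaledVelocity_toNNReal {Ω : Type*} (lam : ℝ≥0) (u : ℝ≥0 → Ω → E3 → E3) (s : ℝ) (ω : Ω) :
    scaledVelocity lam u s.toNNReal ω = dilate ((lam : ℝ) ^ (-1 / 3 : ℝ)) lam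
      (u (((lam ^ (2 / 3 : ℝ) : ℝ≥0) : ℝ) * s).toNNReal ω) := by
  rw [scaledVelocity_eq_dilate, toNNReal_mul_coe]

/-- An arbitrary `f` is the dilation of its inverse dilation, so the rule for two dilated fields
applies. This moves adaptedness and weak continuity back to `u`. -/
lemma pairing_scaledVelocity {Ω : Type*} {lam : ℝ≥0} (hlam : 0 < lam) (L : ℝ)
    (u : ℝ≥0 → Ω → E3 → E3) (t : ℝ≥0) (ω : Ω) (f : E3 → E3) :
    pairing (L / lam) (scaledVelocity lam u t ω) f
      = (lam : ℝ) ^ (-1 / 3 : ℝ) * ((lam : ℝ) ^ 3)⁻¹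
        * pairing L (u (lam ^ (2 / 3 : ℝ) * t) ω) (dilate 1 (lam : ℝ)⁻¹ f) := by
  have h := pairing_dilate (NNReal.coe_pos.2 hlam) ((lam : ℝ) ^ (-1 / 3 : ℝ)) 1 L
    (u (lam ^ (2 / 3 : ℝ) * t) ω) (dilate 1 (lam : ℝ)⁻¹ f)
  rwa [dilate_one_inv (NNReal.coe_pos.2 hlam).ne', mul_one] at h

/-- The terms of the equation for the scaled velocity, tested against `ψ`, are those of the original
equation at the time `lam^{2/3} t`, tested against `ψ (lam⁻¹ ·)`, up to a common factor. -/
lemma equation_scaled {Ω ι : Type*} {lam : ℝ≥0} (hlam : 0 < lam) (L ν : ℝ) (σ : ι → ℝ)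
    (e : ι → E3 → E3) (β : ι → ℝ≥0 → Ω → ℝ) (u : ℝ≥0 → Ω → E3 → E3) (ω : Ω) (t : ℝ≥0)
    {ψ : E3 → E3} (hψ : ContDiff ℝ 2 ψ) {P R : ℝ}
    (hR : R = (lam : ℝ) ^ (-1 / 3 : ℝ) * ((lam : ℝ) ^ 3)⁻¹ * P)
    (h : IntervalIntegrable
        (fun s : ℝ => viscousTerm L ν (u s.toNNReal ω) (dilate 1 (lam : ℝ)⁻¹ ψ)) volume 0
        (lam ^ (2 / 3 : ℝ) * t : ℝ≥0) ∧
      IntervalIntegrable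
        (fun s : ℝ => transportTerm L (u s.toNNReal ω) (dilate 1 (lam : ℝ)⁻¹ ψ)) volume 0
        (lam ^ (2 / 3 : ℝ) * t : ℝ≥0) ∧
      HasSum (fun i => σ i * β i (lam ^ (2 / 3 : ℝ) * t) ω
          * pairing L (e i) (dilate 1 (lam : ℝ)⁻¹ ψ))
        (pairing L (u (lam ^ (2 / 3 : ℝ) * t) ω) (dilate 1 (lam : ℝ)⁻¹ ψ)
          - pairing L (u 0 ω) (dilate 1 (lam : ℝ)⁻¹ ψ)
          + (∫ s in (0 : ℝ)..(lam ^ (2 / 3 : ℝ) * t : ℝ≥0),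
              viscousTerm L ν (u s.toNNReal ω) (dilate 1 (lam : ℝ)⁻¹ ψ))
          - (∫ s in (0 : ℝ)..(lam ^ (2 / 3 : ℝ) * t : ℝ≥0),
              transportTerm L (u s.toNNReal ω) (dilate 1 (lam : ℝ)⁻¹ ψ)) - P)) :
    IntervalIntegrable
        (fun s : ℝ => viscousTerm (L / lam) ν (scaledVelocity lam u s.toNNReal ω) ψ) volume 0 t ∧
      IntervalIntegrable
        (fun s : ℝ => transportTerm (L / lam) (scaledVelocity lam u s.toNNReal ω) ψ) volume 0 t ∧
      HasSum (fun i => σ i * scaledNoise lam β i t ω * pairing (L / lam) (scaledField lam e i) ψ)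
        (pairing (L / lam) (scaledVelocity lam u t ω) ψ
          - pairing (L / lam) (scaledVelocity lam u 0 ω) ψ
          + (∫ s in (0 : ℝ)..t, viscousTerm (L / lam) ν (scaledVelocity lam u s.toNNReal ω) ψ)
          - (∫ s in (0 : ℝ)..t, transportTerm (L / lam) (scaledVelocity lam u s.toNNReal ω) ψ)
          - R) := by
  have hc : (0 : ℝ) < lam := hlam
  obtain ⟨hca, hτa⟩ := amplitude_pow hlam
  have hψ' : dilate 1 (lam : ℝ) (dilate 1 (lam : ℝ)⁻¹ ψ) = ψ := dilate_one_inv hc.ne' ψ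
  have hsmooth : ContDiff ℝ 2 (dilate 1 (lam : ℝ)⁻¹ ψ) := contDiff_dilate 1 _ hψ
  have ha : (0 : ℝ) < (lam : ℝ) ^ (-1 / 3 : ℝ) := Real.rpow_pos_of_pos hc _
  have hpair := fun s => pairing_scaledVelocity hlam L u s ω ψ
  have hfield : ∀ i, pairing (L / lam) (scaledField lam e i) ψ
      = ((lam : ℝ) ^ 3)⁻¹ * pairing L (e i) (dilate 1 (lam : ℝ)⁻¹ ψ) := fun i => by
    have h := pairing_dilate hc 1 1 L (e i) (dilate 1 (lam : ℝ)⁻¹ ψ)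
    rwa [hψ', ← scaledField_eq_dilate, mul_one, one_mul] at h
  have hvisc : ∀ s : ℝ, viscousTerm (L / lam) ν (scaledVelocity lam u s.toNNReal ω) ψ
      = ((lam : ℝ) ^ (-1 / 3 : ℝ)) ^ 5 * (lam : ℝ) ^ 2 * ((lam : ℝ) ^ 3)⁻¹
        * viscousTerm L ν (u (((lam ^ (2 / 3 : ℝ) : ℝ≥0) : ℝ) * s).toNNReal ω)
          (dilate 1 (lam : ℝ)⁻¹ ψ) :=
    fun s => by
      have h := viscousTerm_dilate hc ((lam : ℝ) ^ (-1 / 3 : ℝ)) L ν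
        (u (((lam ^ (2 / 3 : ℝ) : ℝ≥0) : ℝ) * s).toNNReal ω) hsmooth
      rwa [hψ', ← scaledVelocity_toNNReal] at h
  have htrans : ∀ s : ℝ, transportTerm (L / lam) (scaledVelocity lam u s.toNNReal ω) ψ
      = ((lam : ℝ) ^ (-1 / 3 : ℝ)) ^ 2 * (lam : ℝ) * ((lam : ℝ) ^ 3)⁻¹
        * transportTerm L (u (((lam ^ (2 / 3 : ℝ) : ℝ≥0) : ℝ) * s).toNNReal ω)
          (dilate 1 (lam : ℝ)⁻¹ ψ) :=
    fun s => by
      have h := transportTerm_dilate hc ((lam : ℝ) ^ (-1 / 3 : ℝ)) L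
        (u (((lam ^ (2 / 3 : ℝ) : ℝ≥0) : ℝ) * s).toNNReal ω) (dilate 1 (lam : ℝ)⁻¹ ψ)
      rwa [hψ', ← scaledVelocity_toNNReal] at h
  simp only [hpair, hfield, hvisc, htrans, NNReal.coe_mul, mul_zero] at h ⊢
  have hτ : ((lam ^ (2 / 3 : ℝ) : ℝ≥0) : ℝ) ≠ 0 := by rw [hτa]; positivity
  refine ⟨intervalIntegrable_comp_mul_left hτ _ _ h.1,
    intervalIntegrable_comp_mul_left hτ _ _ h.2.1, ?_⟩
  rw [intervalIntegral_comp_mul_left hτ _ (t : ℝ) fun r =>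
      viscousTerm L ν (u r.toNNReal ω) (dilate 1 (lam : ℝ)⁻¹ ψ),
    intervalIntegral_comp_mul_left hτ _ (t : ℝ) fun r =>
      transportTerm L (u r.toNNReal ω) (dilate 1 (lam : ℝ)⁻¹ ψ), hR]
  -- The balance a⁴c² = τ.
  have hvisc_factor : ((lam : ℝ) ^ (-1 / 3 : ℝ)) ^ 5 * (lam : ℝ) ^ 2 * ((lam : ℝ) ^ 3)⁻¹
      * ((lam ^ (2 / 3 : ℝ) : ℝ≥0) : ℝ)⁻¹ = (lam : ℝ) ^ (-1 / 3 : ℝ) * ((lam : ℝ) ^ 3)⁻¹ := by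
    rw [hτa]
    generalize (lam : ℝ) ^ (-1 / 3 : ℝ) = a at *
    rw [hca]
    field_simp
  -- The balance ac = τ.
  have htrans_factor : ((lam : ℝ) ^ (-1 / 3 : ℝ)) ^ 2 * (lam : ℝ) * ((lam : ℝ) ^ 3)⁻¹
      * ((lam ^ (2 / 3 : ℝ) : ℝ≥0) : ℝ)⁻¹ = (lam : ℝ) ^ (-1 / 3 : ℝ) * ((lam : ℝ) ^ 3)⁻¹ := by
    rw [hτa]
    generalize (lam : ℝ) ^ (-1 / 3 : ℝ) = a at *
    rw [hca]
    field_simp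
  rw [hvisc_factor, htrans_factor]
  convert h.2.2.mul_left ((lam : ℝ) ^ (-1 / 3 : ℝ) * ((lam : ℝ) ^ 3)⁻¹) using 1
  · rfl
  · ext1 i
    simp only [scaledNoise]
    ring
  · ring

lemma isWeakSolution_scaled {Ω ι : Type*} {m : MeasurableSpace Ω} {Q : Measure Ω}
    {𝓕 : Filtration ℝ≥0 m} {β : ι → ℝ≥0 → Ω → ℝ} {L ν : ℝ} {σ : ι → ℝ} {e : ι → E3 → E3}
    {u : ℝ≥0 → Ω → E3 → E3} (hu : IsWeakSolution Q 𝓕 β L ν σ e u) {lam : ℝ≥0} (hlam : 0 < lam) :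
    IsWeakSolution Q (scaledFiltration lam 𝓕) (scaledNoise lam β) (L / lam) ν σ
      (scaledField lam e) (scaledVelocity lam u) := by
  have hc : (0 : ℝ) < lam := hlam
  have hL : L / (lam : ℝ) / (lam : ℝ)⁻¹ = L := by field_simp
  have ha : (lam : ℝ) ^ (-1 / 3 : ℝ) ≠ 0 := (Real.rpow_pos_of_pos hc _).ne'
  have hτ : (0 : ℝ) < (lam ^ (2 / 3 : ℝ) : ℝ≥0) := NNReal.coe_pos.2 (NNReal.rpow_pos hlam)
  have hH : ∀ {v : E3 → E3}, MemH (L / lam) v → MemH L (dilate 1 (lam : ℝ)⁻¹ v) := fun hv => by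
    have h := hv.dilate (inv_pos.2 hc) 1
    rwa [hL] at h
  refine ⟨fun t v hv => ?_, ?_, ?_, ?_, ?_, fun ψ hψ => ?_⟩
  · simp only [pairing_scaledVelocity hlam]
    exact (hu.adapted _ _ (hH hv)).const_mul _
  · filter_upwards [hu.memH] with ω hω t
    exact (hω _).dilate hc _
  · filter_upwards [hu.weakly_continuous] with ω hω v hv
    simp only [pairing_scaledVelocity hlam]
    exact continuous_const.mul ((hω _ (hH hv)).comp (continuous_const.mul continuous_id))
  · filter_upwards [hu.bounded] with ω hω T
    obtain ⟨C, hC⟩ := hω (lam ^ (2 / 3 : ℝ) * T)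
    refine ⟨(lam : ℝ) ^ (-1 / 3 : ℝ) * (lam : ℝ) ^ (-1 / 3 : ℝ) * ((lam : ℝ) ^ 3)⁻¹ * C,
      fun t ht => ?_⟩
    rw [scaledVelocity_eq_dilate, pairing_dilate hc]
    exact mul_le_mul_of_nonneg_left (hC _ (by gcongr)) (by positivity)
  · filter_upwards [hu.memX] with ω hω T
    simp only [scaledVelocity_toNNReal]
    refine (lintegral_mono fun s => X6_dilate_le hc ha L _).trans_lt ?_
    -- Finiteness of the constant replaces measurability of the integrand.
    rw [lintegral_const_mul' _ _ ENNReal.ofReal_ne_top,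
      lintegral_Icc_comp_mul_left hτ T fun r => X6 L (u r.toNNReal ω)]
    have h := hω (lam ^ (2 / 3 : ℝ) * T)
    rw [NNReal.coe_mul] at h
    exact ENNReal.mul_lt_top ENNReal.ofReal_lt_top (ENNReal.mul_lt_top ENNReal.ofReal_lt_top h)
  · have hψ' := hψ.dilate (inv_pos.2 hc) 1
    rw [hL] at hψ'
    filter_upwards [hu.equation _ hψ'] with ω hω t
    -- The projected equation is the case of zero pressure contribution.
    have h := equation_scaled hlam L ν σ e β u ω t (hψ.smooth.of_le (by norm_cast))
      (P := 0) (R := 0) (by simp) (by simpa only [sub_zero] using hω (lam ^ (2 / 3 : ℝ) * t))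
    simpa only [sub_zero] using h

/-- The scaled pressure `lam^{-2/3} q (lam^{2/3} t, lam x)`. -/
def scaledPressure {Ω : Type*} (lam : ℝ≥0) (q : ℝ≥0 → Ω → E3 → ℝ) : ℝ≥0 → Ω → E3 → ℝ :=
  fun t ω x => ((lam : ℝ) ^ (-1 / 3 : ℝ)) ^ 2 * q (lam ^ (2 / 3 : ℝ) * t) ω ((lam : ℝ) • x)

lemma isPressure_scaled {Ω ι : Type*} {m : MeasurableSpace Ω} {Q : Measure Ω}
    {β : ι → ℝ≥0 → Ω → ℝ} {L ν : ℝ} {σ : ι → ℝ} {e : ι → E3 → E3}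
    {u : ℝ≥0 → Ω → E3 → E3} {q : ℝ≥0 → Ω → E3 → ℝ} (hq : IsPressure Q β L ν σ e u q)
    {lam : ℝ≥0} (hlam : 0 < lam) :
    IsPressure Q (scaledNoise lam β) (L / lam) ν σ (scaledField lam e) (scaledVelocity lam u)
      (scaledPressure lam q) := by
  have hc : (0 : ℝ) < lam := hlam
  have hL : L / (lam : ℝ) / (lam : ℝ)⁻¹ = L := by field_simp
  have hτ : (0 : ℝ) < (lam ^ (2 / 3 : ℝ) : ℝ≥0) := NNReal.coe_pos.2 (NNReal.rpow_pos hlam)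
  obtain ⟨hca, hτa⟩ := amplitude_pow hlam
  have hq_eq : ∀ (s : ℝ) ω x, scaledPressure lam q s.toNNReal ω x
      = ((lam : ℝ) ^ (-1 / 3 : ℝ)) ^ 2
        * q (((lam ^ (2 / 3 : ℝ) : ℝ≥0) : ℝ) * s).toNNReal ω ((lam : ℝ) • x) := fun s ω x => by
    rw [scaledPressure, toNNReal_mul_coe]
  refine ⟨?_, ?_, fun ψ hψ => ?_⟩
  · filter_upwards [hq.periodic] with ω hω
    rw [ae_restrict_iff' measurableSet_Ici] at hω ⊢
    -- Periodicity is known only for almost every time; the preimage under s ↦ τs of a null set of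
    -- times is null.
    filter_upwards [(Measure.quasiMeasurePreserving_smul volume hτ.ne').ae hω] with s hs hs0
    have h := (hs (mul_nonneg hτ.le hs0)).comp_smul hc.ne'
    have h' := h.comp fun y => ((lam : ℝ) ^ (-1 / 3 : ℝ)) ^ 2 * y
    simpa only [IsAEPeriodic, hq_eq, smul_eq_mul] using h'
  · filter_upwards [hq.integrable] with ω hω T
    have h := hω (lam ^ (2 / 3 : ℝ) * T)
    rw [NNReal.coe_mul] at h
    simp only [hq_eq]
    exact (integrableOn_Icc_prod_cube_comp_smul hτ hc T L h).const_mul _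
  · have hψ' := hψ.dilate (inv_pos.2 hc).ne' 1
    rw [hL] at hψ'
    filter_upwards [hq.equation _ hψ'] with ω hω t
    refine equation_scaled hlam L ν σ e β u ω t (hψ.1.of_le (by norm_cast)) ?_
      (hω (lam ^ (2 / 3 : ℝ) * t))
    have hterm : ∀ s : ℝ,
        ∫ x in cube (L / lam), scaledPressure lam q s.toNNReal ω x * divergence ψ x
        = ((lam : ℝ) ^ (-1 / 3 : ℝ)) ^ 2 * (lam : ℝ) * ((lam : ℝ) ^ 3)⁻¹
          * ∫ x in cube L, q (((lam ^ (2 / 3 : ℝ) : ℝ≥0) : ℝ) * s).toNNReal ω x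
            * divergence (dilate 1 (lam : ℝ)⁻¹ ψ) x := fun s => by
      have h := pressureTerm_dilate hc (((lam : ℝ) ^ (-1 / 3 : ℝ)) ^ 2) L
        (q (((lam ^ (2 / 3 : ℝ) : ℝ≥0) : ℝ) * s).toNNReal ω) (dilate 1 (lam : ℝ)⁻¹ ψ)
      rw [dilate_one_inv hc.ne'] at h
      simpa only [hq_eq] using h
    simp only [hterm]
    rw [intervalIntegral_comp_mul_left hτ.ne' _ (t : ℝ) fun r =>
      ∫ x in cube L, q r.toNNReal ω x * divergence (dilate 1 (lam : ℝ)⁻¹ ψ) x, NNReal.coe_mul]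
    congr 1
    -- With pressure amplitude a², the balance is a²cτ⁻¹ = a, again ac = τ.
    rw [hτa]
    have ha : (0 : ℝ) < (lam : ℝ) ^ (-1 / 3 : ℝ) := Real.rpow_pos_of_pos hc _
    generalize (lam : ℝ) ^ (-1 / 3 : ℝ) = a at *
    rw [hca]
    field_simp

end Prouse

end

theorem mainTheorem7 {Ω : Type*} {m : MeasurableSpace Ω} (Q : Measure Ω) [IsProbabilityMeasure Q]
    (𝓕 : Filtration ℝ≥0 m) (β : Prouse.Idx → ℝ≥0 → Ω → ℝ)
    (hβ : Prouse.IsBrownianBasis Q 𝓕 β)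
    (L ν : ℝ) (hL : 0 < L) (hν : 0 < ν)
    (v : Prouse.ZPlus → Fin 2 → Prouse.E3) (hv : Prouse.IsPolarization v)
    (σ : Prouse.Idx → ℝ) (hσ : Summable fun i => σ i ^ 2)
    (lam : ℝ≥0) (hlam0 : 0 < lam) (hlam1 : lam < 1)
    (u : ℝ≥0 → Ω → Prouse.E3 → Prouse.E3)
    (hu : Prouse.IsWeakSolution Q 𝓕 β L ν σ (Prouse.eigenField L v) u) :
    Prouse.IsBrownianBasis Q (Prouse.scaledFiltration lam 𝓕) (Prouse.scaledNoise lam β) ∧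
    Prouse.IsWeakSolution Q (Prouse.scaledFiltration lam 𝓕) (Prouse.scaledNoise lam β)
      (L / lam) ν σ (Prouse.scaledField lam (Prouse.eigenField L v))
      (Prouse.scaledVelocity lam u) ∧
    ∀ q : ℝ≥0 → Ω → Prouse.E3 → ℝ,
      Prouse.IsPressure Q β L ν σ (Prouse.eigenField L v) u q →
      ∃ qlam : ℝ≥0 → Ω → Prouse.E3 → ℝ,
        Prouse.IsPressure Q (Prouse.scaledNoise lam β) (L / lam) ν σ
          (Prouse.scaledField lam (Prouse.eigenField L v)) (Prouse.scaledVelocity lam u) qlam := by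
  exact ⟨Prouse.isBrownianBasis_scaled hβ hlam0, Prouse.isWeakSolution_scaled hu hlam0,
    fun q hq => ⟨Prouse.scaledPressure lam q, Prouse.isPressure_scaled hq hlam0⟩⟩
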